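/- Let $0<a<b$ and let $d:\mathbb R\to[0,\infty)$ be the density of a probability distribution supported in $[a,b]$, that is, $d(x)=0$ for $x\notin[a,b]$ and $\int_{\mathbb R}d(x)\,dx=1$. Assume that $d$ is continuous on $[a,b]$ (one-sidedly at the end points), twice continuously differentiable on $(a,b)$, and that $d(a)\,d(b)\neq 0$. For $n\ge 1$ let $d^{*n}=d*d*\cdots*d$ ($n$ factors) be the $n$-fold convolution of $d$ with itself, and put $$F_d(x)=\sum_{n=1}^\infty \frac{d^{*n}(x)}{n}\qquad(x>0),$$ where, for each $x$, only finitely many terms are nonzero, because $d^{*n}(x)=0$ for $x<na$. Then $$F_d\in\big(L^1_{\mathrm w}(\mathbb R_+)\setminus L^1(\mathbb R_+)\big)\cap L^2(\mathbb R_+),$$ where $\mathbb R_+=(0,\infty)$ carries Lebesgue measure $\operatorname{mes}$, and $L^1_{\mathrm w}(\mathbb R_+)$ is the weak $L^1$ space, consisting of the measurable functions $f$ with $\sup_{t>0}\,t\cdot\operatorname{mes}\{x>0:|f(x)|>t\}<\infty$. -/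

import Mathlib

open MeasureTheory Set

open scoped ENNReal NNReal

namespace ConvolutionSeries

/-- The `n`-fold convolution `d * d * ... * d` (`n` factors, `n ≥ 1`) of a function on the line
with itself, for Lebesgue measure. The value at `n = 0` is a placeholder and is never used. -/
noncomputable def convPow (d : ℝ → ℝ) : ℕ → ℝ → ℝ
  | 0 => 0
  | 1 => d
  | n + 2 => convolution (convPow d (n + 1)) d (ContinuousLinearMap.mul ℝ ℝ) volume

/-- `F_d(x) = ∑_{n ≥ 1} d^{*n}(x) / n`, the pointwise sum; the index `n` below stands for
`n + 1`. -/
noncomputable def F (d : ℝ → ℝ) (x : ℝ) : ℝ :=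
  ∑' n : ℕ, convPow d (n + 1) x / ((n + 1 : ℕ) : ℝ)

/-- Membership in weak `L¹(μ)`: `f` is (a.e. strongly) measurable and
`sup_{t ≥ 0} t * μ {x | |f x| > t}` is finite. -/
def MemWeakL1 (f : ℝ → ℝ) (μ : Measure ℝ) : Prop :=
  AEStronglyMeasurable f μ ∧ (⨆ t : ℝ≥0, (t : ℝ≥0∞) * μ {x | (t : ℝ) < |f x|}) < ∞

/-- `d^{*n}(x) = 0` for `x < n a`, if `d` vanishes to the left of `a`. -/
theorem convPow_eq_zero {d : ℝ → ℝ} {a : ℝ} (hd : ∀ x, x < a → d x = 0) (n : ℕ) :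
    ∀ x, x < ((n + 1 : ℕ) : ℝ) * a → convPow d (n + 1) x = 0 := by
  induction n with
  | zero => intro x hx; exact hd x (by simpa using hx)
  | succ n ih =>
    intro x hx
    have h : ∀ t, convPow d (n + 1) t * d (x - t) = 0 := by
      intro t
      by_cases ht : t < ((n + 1 : ℕ) : ℝ) * a
      · rw [ih t ht, zero_mul]
      · rw [hd (x - t) (by push_cast at hx ht; linarith), mul_zero]
    simp [convPow, convolution, h]

/-- The series defining `F d x` has only finitely many nonzero terms, so its sum is a genuine
finite sum. -/
theorem finite_support_series {d : ℝ → ℝ} {a : ℝ} (ha : 0 < a) (hd : ∀ x, x < a → d x = 0)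
    (x : ℝ) :
    (Function.support fun n : ℕ => convPow d (n + 1) x / ((n + 1 : ℕ) : ℝ)).Finite := by
  obtain ⟨N, hN⟩ := exists_nat_gt (x / a)
  refine (Set.finite_lt_nat N).subset fun n hn => ?_
  by_contra hlt
  apply hn
  have h1 : (N : ℝ) ≤ n := by exact_mod_cast not_lt.mp hlt
  have h2 : x < N * a := (div_lt_iff₀ ha).mp hN
  have h3 : x < ((n + 1 : ℕ) : ℝ) * a := by push_cast; nlinarith
  simp only [convPow_eq_zero hd n x h3, zero_div]

end ConvolutionSeries

namespace ConvolutionSeries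

/-! Everything follows from `F d x ≤ C / x` for `x > 0`, together with `F d = 0` left of `a`: these
give weak `L¹` and `L²`. For the bound, `d^{*n}(x) ≠ 0` forces `1/n ≤ b/x`, so `F d x` is at most
`b/x` times the renewal density `u = ∑ d^{*n}`. Since `u = d + d * u` with `d` bounded and supported
in `[a, b]`, `u` is bounded once its mass on intervals of length `a` is (`exists_renewalSum_le`).
Integrability fails because each `d^{*n}` has mass one, so `F d` has the mass of the harmonic
series. -/

section

variable {d : ℝ → ℝ} {a b M : ℝ}

/-! ### Convolution powers -/

theorem convPow_succ_apply (d : ℝ → ℝ) (n : ℕ) (x : ℝ) :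
    convPow d (n + 2) x = ∫ s, d s * convPow d (n + 1) (x - s) := by
  have h := integral_sub_left_eq_self (fun s => d s * convPow d (n + 1) (x - s)) volume x
  rw [← h]
  simp [convPow, convolution, mul_comm]

theorem convPow_nonneg (hd : ∀ x, 0 ≤ d x) (n : ℕ) : ∀ x, 0 ≤ convPow d (n + 1) x := by
  induction n with
  | zero => exact hd
  | succ n ih =>
    intro x
    rw [convPow_succ_apply]
    exact integral_nonneg fun s => mul_nonneg (hd s) (ih _)

theorem measurable_convPow (hm : Measurable d) (n : ℕ) : Measurable (convPow d (n + 1)) := by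
  induction n with
  | zero => exact hm
  | succ n ih =>
    have h : convPow d (n + 2) = fun x => ∫ s, d s * convPow d (n + 1) (x - s) :=
      funext (convPow_succ_apply d n)
    rw [h]
    have h2 : Measurable fun p : ℝ × ℝ => d p.2 * convPow d (n + 1) (p.1 - p.2) := by fun_prop
    exact h2.stronglyMeasurable.integral_prod_right.measurable

/-- `d^{*n}(x) = 0` for `x > n b`, if `d` vanishes to the right of `b`. -/
theorem convPow_eq_zero_of_gt (hd : ∀ x, b < x → d x = 0) (n : ℕ) :
    ∀ x, ((n + 1 : ℕ) : ℝ) * b < x → convPow d (n + 1) x = 0 := by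
  induction n with
  | zero => intro x hx; exact hd x (by simpa using hx)
  | succ n ih =>
    intro x hx
    rw [convPow_succ_apply]
    refine integral_eq_zero_of_ae (.of_forall fun s => ?_)
    by_cases hs : b < s
    · simp [hd s hs]
    · simp [ih (x - s) (by push_cast at hx ⊢; linarith)]

theorem integrable_mul_of_bound {g : ℝ → ℝ} (hi : Integrable d) (hg : Measurable g)
    (h0 : ∀ x, 0 ≤ g x) (hb : ∀ x, g x ≤ M) (x : ℝ) :
    Integrable fun s => d s * g (x - s) := by
  refine hi.mul_bdd (c := M)
    (hg.comp (measurable_const.sub measurable_id)).aestronglyMeasurable (.of_forall fun s => ?_)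
  rw [Real.norm_of_nonneg (h0 _)]
  exact hb _

/-- Convolving with a probability density averages translates, so bounds persist. This makes the
convolution integrands integrable. -/
theorem convPow_le (hd : ∀ x, 0 ≤ d x) (hm : Measurable d) (hi : Integrable d)
    (h1 : ∫ x, d x = 1) (hM : ∀ x, d x ≤ M) (n : ℕ) : ∀ x, convPow d (n + 1) x ≤ M := by
  induction n with
  | zero => exact hM
  | succ n ih =>
    intro x
    rw [convPow_succ_apply]
    calc ∫ s, d s * convPow d (n + 1) (x - s) ≤ ∫ s, d s * M :=
          integral_mono
            (integrable_mul_of_bound hi (measurable_convPow hm n) (convPow_nonneg hd n) ih x)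
            (hi.mul_const M) fun s => mul_le_mul_of_nonneg_left (ih _) (hd s)
      _ = M := by rw [integral_mul_const, h1, one_mul]

theorem integrable_mul_convPow (hd : ∀ x, 0 ≤ d x) (hm : Measurable d) (hi : Integrable d)
    (h1 : ∫ x, d x = 1) (hM : ∀ x, d x ≤ M) (n : ℕ) (x : ℝ) :
    Integrable fun s => d s * convPow d (n + 1) (x - s) :=
  integrable_mul_of_bound hi (measurable_convPow hm n) (convPow_nonneg hd n)
    (convPow_le hd hm hi h1 hM n) x

theorem ofReal_convPow_succ (hd : ∀ x, 0 ≤ d x) (hm : Measurable d) (hi : Integrable d)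
    (h1 : ∫ x, d x = 1) (hM : ∀ x, d x ≤ M) (n : ℕ) (x : ℝ) :
    ENNReal.ofReal (convPow d (n + 2) x) =
      ∫⁻ s, ENNReal.ofReal (d s) * ENNReal.ofReal (convPow d (n + 1) (x - s)) := by
  rw [convPow_succ_apply, ofReal_integral_eq_lintegral_ofReal
    (integrable_mul_convPow hd hm hi h1 hM n x)
    (.of_forall fun s => mul_nonneg (hd s) (convPow_nonneg hd n _))]
  simp_rw [ENNReal.ofReal_mul (hd _)]

theorem lintegral_ofReal_density (hd : ∀ x, 0 ≤ d x) (hi : Integrable d) (h1 : ∫ x, d x = 1) :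
    ∫⁻ x, ENNReal.ofReal (d x) = 1 := by
  rw [← ofReal_integral_eq_lintegral_ofReal hi (.of_forall hd), h1, ENNReal.ofReal_one]

theorem lintegral_ofReal_convPow (hd : ∀ x, 0 ≤ d x) (hm : Measurable d) (hi : Integrable d)
    (h1 : ∫ x, d x = 1) (hM : ∀ x, d x ≤ M) (n : ℕ) :
    ∫⁻ x, ENNReal.ofReal (convPow d (n + 1) x) = 1 := by
  induction n with
  | zero => exact lintegral_ofReal_density hd hi h1
  | succ n ih =>
    have hg := measurable_convPow hm n
    simp_rw [ofReal_convPow_succ hd hm hi h1 hM n]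
    rw [lintegral_lintegral_swap (by fun_prop)]
    calc _ = ∫⁻ s, ENNReal.ofReal (d s) := by
          refine lintegral_congr fun s => ?_
          rw [lintegral_const_mul _ (by fun_prop),
            lintegral_sub_right_eq_self (fun x => ENNReal.ofReal (convPow d (n + 1) x)) s, ih,
            mul_one]
      _ = 1 := lintegral_ofReal_density hd hi h1

/-! ### Boundedness of the renewal density -/

/-- The partial sums `∑_{n=1}^N d^{*n}` of the renewal density. -/
noncomputable def renewalSum (d : ℝ → ℝ) (N : ℕ) (x : ℝ) : ℝ≥0∞ :=
  ∑ n ∈ Finset.range N, ENNReal.ofReal (convPow d (n + 1) x)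

theorem measurable_renewalSum (hm : Measurable d) (N : ℕ) : Measurable (renewalSum d N) := by
  unfold renewalSum
  have := measurable_convPow hm
  fun_prop

theorem renewalSum_succ (hd : ∀ x, 0 ≤ d x) (hm : Measurable d) (hi : Integrable d)
    (h1 : ∫ x, d x = 1) (hM : ∀ x, d x ≤ M) (N : ℕ) (x : ℝ) :
    renewalSum d (N + 1) x =
      ENNReal.ofReal (d x) + ∫⁻ s, ENNReal.ofReal (d s) * renewalSum d N (x - s) := by
  have hg := measurable_convPow hm
  simp_rw [renewalSum, Finset.mul_sum]
  rw [lintegral_finsetSum _ (fun n _ => by fun_prop), Finset.sum_range_succ', add_comm]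
  simp_rw [← ofReal_convPow_succ hd hm hi h1 hM]
  simp [convPow]

theorem renewalSum_eq_zero (ha : 0 < a) (hs : ∀ x, x < a → d x = 0) (N : ℕ) {x : ℝ}
    (hx : x < a) : renewalSum d N x = 0 := by
  refine Finset.sum_eq_zero fun n _ => ?_
  rw [convPow_eq_zero hs n x, ENNReal.ofReal_zero]
  push_cast
  nlinarith [mul_nonneg (n.cast_nonneg : (0 : ℝ) ≤ n) ha.le]

/-- The renewal process with steps at least `a` visits an interval of length `a` at most once. -/
theorem setLIntegral_renewalSum_le_one (ha : 0 < a) (hs : ∀ x, x < a → d x = 0)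
    (hd : ∀ x, 0 ≤ d x) (hm : Measurable d) (hi : Integrable d)
    (h1 : ∫ x, d x = 1) (hM : ∀ x, d x ≤ M) (N : ℕ) :
    ∀ y, ∫⁻ x in Ico y (y + a), renewalSum d N x ≤ 1 := by
  induction N with
  | zero => simp [renewalSum]
  | succ N ih =>
    intro y
    have hg := measurable_renewalSum hm N
    simp_rw [renewalSum_succ hd hm hi h1 hM N]
    rw [lintegral_add_left (by fun_prop), lintegral_lintegral_swap (by fun_prop)]
    -- Condition on the first step `s`. If `s < y`, induction applies to the shifted window;
    -- otherwise `x - s < a`, too short for another step.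
    have key : ∀ s, ∫⁻ x in Ico y (y + a), ENNReal.ofReal (d s) * renewalSum d N (x - s) ≤
        (Iio y).indicator (fun s => ENNReal.ofReal (d s)) s := by
      intro s
      rw [lintegral_const_mul _ (by fun_prop)]
      by_cases hsy : s < y
      · rw [indicator_of_mem (mem_Iio.2 hsy)]
        have h := ih (y - s)
        rw [← lintegral_indicator measurableSet_Ico,
          ← lintegral_sub_right_eq_self _ s] at h
        have e : ∀ x, (Ico (y - s) (y - s + a)).indicator (renewalSum d N) (x - s) =
            (Ico y (y + a)).indicator (fun x => renewalSum d N (x - s)) x := by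
          intro x
          have : x - s ∈ Ico (y - s) (y - s + a) ↔ x ∈ Ico y (y + a) := by
            simp only [mem_Ico]
            constructor <;> rintro ⟨_, _⟩ <;> constructor <;> linarith
          by_cases hx : x ∈ Ico y (y + a)
          · rw [indicator_of_mem hx, indicator_of_mem (this.2 hx)]
          · rw [indicator_of_notMem hx, indicator_of_notMem (mt this.1 hx)]
        simp_rw [e] at h
        rw [lintegral_indicator measurableSet_Ico] at h
        exact mul_le_of_le_one_right' h
      · rw [setLIntegral_congr_fun (g := fun _ => 0) measurableSet_Ico]
        · simp
        · intro x hx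
          exact renewalSum_eq_zero ha hs N (by linarith [hx.2, not_lt.1 hsy])
    -- A first step inside the window and one before it are disjoint events.
    calc _ ≤ (∫⁻ x in Ico y (y + a), ENNReal.ofReal (d x)) +
              ∫⁻ x in Iio y, ENNReal.ofReal (d x) := by
          rw [← lintegral_indicator measurableSet_Iio]
          exact add_le_add le_rfl (lintegral_mono key)
      _ = ∫⁻ x in Ico y (y + a) ∪ Iio y, ENNReal.ofReal (d x) := by
          rw [lintegral_union measurableSet_Iio]
          exact disjoint_left.2 fun x hx hx' => absurd hx.1 (not_le.2 hx')
      _ ≤ ∫⁻ x, ENNReal.ofReal (d x) := setLIntegral_le_lintegral _ _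
      _ = 1 := lintegral_ofReal_density hd hi h1

theorem setLIntegral_renewalSum_le (ha : 0 < a) (hs : ∀ x, x < a → d x = 0)
    (hd : ∀ x, 0 ≤ d x) (hm : Measurable d) (hi : Integrable d)
    (h1 : ∫ x, d x = 1) (hM : ∀ x, d x ≤ M) (N k : ℕ) (y : ℝ) :
    ∫⁻ x in Ico y (y + k * a), renewalSum d N x ≤ k := by
  induction k with
  | zero => simp
  | succ k ih =>
    have hsub : Ico y (y + (k + 1 : ℕ) * a) ⊆
        Ico y (y + k * a) ∪ Ico (y + k * a) (y + k * a + a) := by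
      rintro x ⟨hx1, hx2⟩
      push_cast at hx2
      rcases lt_or_ge x (y + k * a) with h | h
      · exact .inl ⟨hx1, h⟩
      · exact .inr ⟨h, by linarith⟩
    calc _ ≤ _ := lintegral_mono_set hsub
      _ ≤ _ := lintegral_union_le _ _ _
      _ ≤ (k : ℝ≥0∞) + 1 := add_le_add ih
          (setLIntegral_renewalSum_le_one ha hs hd hm hi h1 hM N _)
      _ = _ := by push_cast; rfl

theorem exists_renewalSum_le (ha : 0 < a) (hs : ∀ x, x < a → d x = 0)
    (hs' : ∀ x, b < x → d x = 0) (hd : ∀ x, 0 ≤ d x) (hm : Measurable d) (hi : Integrable d)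
    (h1 : ∫ x, d x = 1) (hM : ∀ x, d x ≤ M) :
    ∃ C : ℝ≥0, ∀ N x, renewalSum d N x ≤ C := by
  obtain ⟨k, hk⟩ := exists_nat_gt (b / a)
  have hk' : b < k * a := (div_lt_iff₀ ha).mp hk
  -- The first `M` bounds `d`; in `d * u` only `[x - b, x - a]` matters, which `k` windows of length
  -- `a` cover.
  refine ⟨M.toNNReal + M.toNNReal * k, fun N x => ?_⟩
  cases N with
  | zero => simp [renewalSum]
  | succ N =>
    have hg := measurable_renewalSum hm N
    rw [renewalSum_succ hd hm hi h1 hM]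
    push_cast
    refine add_le_add (ENNReal.ofReal_le_ofReal (hM x)) ?_
    rw [← lintegral_sub_left_eq_self _ x]
    calc ∫⁻ s, ENNReal.ofReal (d (x - s)) * renewalSum d N (x - (x - s))
        ≤ ∫⁻ s, (Ico (x - b) (x - b + k * a)).indicator
            (fun s => ENNReal.ofReal M * renewalSum d N s) s := by
          refine lintegral_mono fun s => ?_
          rw [sub_sub_cancel]
          by_cases h : s ∈ Ico (x - b) (x - b + k * a)
          · rw [indicator_of_mem h]
            gcongr
            exact hM _
          · have : d (x - s) = 0 := by
              by_cases h' : x - b ≤ s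
              · refine hs _ ?_
                have := not_lt.1 fun h2 => h ⟨h', h2⟩
                linarith
              · exact hs' _ (by linarith [not_le.1 h'])
            simp [this]
      _ ≤ _ := by
          rw [lintegral_indicator measurableSet_Ico, lintegral_const_mul _ hg]
          gcongr
          · rfl
          · exact setLIntegral_renewalSum_le ha hs hd hm hi h1 hM N k _

/-! ### The bound `C / x` and its consequences -/

theorem summable_series (ha : 0 < a) (hs : ∀ x, x < a → d x = 0) (x : ℝ) :
    Summable fun n : ℕ => convPow d (n + 1) x / ((n + 1 : ℕ) : ℝ) :=
  summable_of_hasFiniteSupport (finite_support_series ha hs x)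

theorem measurable_F (ha : 0 < a) (hs : ∀ x, x < a → d x = 0) (hm : Measurable d) :
    Measurable (F d) := by
  have hg := measurable_convPow hm
  refine measurable_of_tendsto_metrizable (f := fun N x => ∑ n ∈ Finset.range N,
    convPow d (n + 1) x / ((n + 1 : ℕ) : ℝ)) (fun N => by fun_prop) ?_
  exact tendsto_pi_nhds.2 fun x => (summable_series ha hs x).hasSum.tendsto_sum_nat

theorem F_nonneg (hd : ∀ x, 0 ≤ d x) (x : ℝ) : 0 ≤ F d x :=
  tsum_nonneg fun n => div_nonneg (convPow_nonneg hd n x) (Nat.cast_nonneg _)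

theorem F_eq_zero (ha : 0 < a) (hs : ∀ x, x < a → d x = 0) {x : ℝ} (hx : x < a) :
    F d x = 0 := by
  have h : ∀ n : ℕ, convPow d (n + 1) x / ((n + 1 : ℕ) : ℝ) = 0 := fun n => by
    rw [convPow_eq_zero hs n x, zero_div]
    push_cast
    nlinarith [mul_nonneg (n.cast_nonneg : (0 : ℝ) ≤ n) ha.le]
  simp only [F, h, tsum_zero]

/-- The series is dominated by `C / x`, because the renewal density is bounded. -/
theorem exists_F_le_div (ha : 0 < a) (hb : 0 < b) (hs : ∀ x, x < a → d x = 0)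
    (hs' : ∀ x, b < x → d x = 0) (hd : ∀ x, 0 ≤ d x) (hm : Measurable d) (hi : Integrable d)
    (h1 : ∫ x, d x = 1) (hM : ∀ x, d x ≤ M) :
    ∃ C : ℝ, ∀ x, 0 < x → F d x ≤ C / x := by
  obtain ⟨C, hC⟩ := exists_renewalSum_le ha hs hs' hd hm hi h1 hM
  refine ⟨b * C, fun x hx => ?_⟩
  refine Real.tsum_le_of_sum_range_le
    (fun n => div_nonneg (convPow_nonneg hd n x) (Nat.cast_nonneg _)) fun N => ?_
  have hsum : ∑ n ∈ Finset.range N, convPow d (n + 1) x ≤ C := by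
    have h := hC N x
    rw [renewalSum, ← ENNReal.ofReal_sum_of_nonneg (fun n _ => convPow_nonneg hd n x)] at h
    exact (ENNReal.ofReal_le_coe).1 h
  calc ∑ n ∈ Finset.range N, convPow d (n + 1) x / ((n + 1 : ℕ) : ℝ)
      ≤ ∑ n ∈ Finset.range N, b / x * convPow d (n + 1) x := by
        refine Finset.sum_le_sum fun n _ => ?_
        -- Only terms with `(n + 1) b ≥ x` survive, and there `1 / (n + 1) ≤ b / x`.
        by_cases h : ((n + 1 : ℕ) : ℝ) * b < x
        · simp [convPow_eq_zero_of_gt hs' n x h]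
        · rw [div_eq_inv_mul]
          refine mul_le_mul_of_nonneg_right ?_ (convPow_nonneg hd n x)
          rw [inv_eq_one_div, div_le_div_iff₀ (by positivity) hx]
          linarith
    _ = b / x * ∑ n ∈ Finset.range N, convPow d (n + 1) x := (Finset.mul_sum _ _ _).symm
    _ ≤ b / x * C := by gcongr
    _ = b * C / x := by ring

theorem memWeakL1_of_le_div {f : ℝ → ℝ} {C : ℝ} (hf : Measurable f)
    (h0 : ∀ x, 0 ≤ f x) (h : ∀ x, 0 < x → f x ≤ C / x) :
    MemWeakL1 f (volume.restrict (Ioi 0)) := by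
  refine ⟨hf.aestronglyMeasurable, lt_of_le_of_lt (iSup_le fun t => ?_)
    (ENNReal.ofReal_lt_top (r := C))⟩
  rcases eq_or_ne t 0 with rfl | ht
  · simp
  have ht' : (0 : ℝ) < t := by positivity
  rw [Measure.restrict_apply' measurableSet_Ioi]
  have hsub : {x | (t : ℝ) < |f x|} ∩ Ioi 0 ⊆ Ioc 0 (C / t) := by
    rintro x ⟨hx, hx0 : 0 < x⟩
    refine ⟨hx0, ?_⟩
    rw [mem_ofPred_eq, abs_of_nonneg (h0 x)] at hx
    have h2 := hx.trans_le (h x hx0)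
    rw [lt_div_iff₀ hx0] at h2
    rw [le_div_iff₀ ht']
    linarith
  calc (t : ℝ≥0∞) * volume ({x | (t : ℝ) < |f x|} ∩ Ioi 0)
      ≤ t * volume (Ioc 0 (C / t)) := by gcongr
    _ = ENNReal.ofReal C := by
        rw [Real.volume_Ioc, sub_zero, ← ENNReal.ofReal_coe_nnreal,
          ← ENNReal.ofReal_mul ht'.le, mul_div_cancel₀ _ ht'.ne']

theorem memLp_two_of_le_div {f : ℝ → ℝ} {C : ℝ} (hf : Measurable f) (ha : 0 < a)
    (h0 : ∀ x, 0 ≤ f x) (hfa : ∀ x, x < a → f x = 0) (h : ∀ x, 0 < x → f x ≤ C / x) :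
    MemLp f 2 (volume.restrict (Ioi 0)) := by
  refine (memLp_two_iff_integrable_sq hf.aestronglyMeasurable).2 (Integrable.restrict ?_)
  -- The cutoff `a / 2` lets the open half-line contain the point `a`.
  have hint : IntegrableOn (fun x : ℝ => C ^ 2 * x ^ (-2 : ℝ)) (Ioi (a / 2)) :=
    (integrableOn_Ioi_rpow_of_lt (by norm_num) (by positivity)).const_mul _
  refine (hint.integrable_indicator measurableSet_Ioi).mono' (by fun_prop)
    (.of_forall fun x => ?_)
  rw [Real.norm_of_nonneg (sq_nonneg _)]
  by_cases hx : x < a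
  · rw [hfa x hx]
    simp only [ne_eq, OfNat.ofNat_ne_zero, not_false_eq_true, zero_pow]
    exact indicator_nonneg (fun y hy => mul_nonneg (sq_nonneg C)
      (Real.rpow_nonneg (by linarith [mem_Ioi.1 hy]) _)) x
  · have hx0 : 0 < x := by linarith
    rw [indicator_of_mem (mem_Ioi.2 (by linarith))]
    calc f x ^ 2 ≤ (C / x) ^ 2 := pow_le_pow_left₀ (h0 x) (h x hx0) 2
      _ = C ^ 2 * x ^ (-2 : ℝ) := by
        rw [Real.rpow_neg hx0.le, Real.rpow_two, div_pow, div_eq_mul_inv]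

/-! ### Failure of integrability -/

theorem tsum_ofReal_harmonic : ∑' n : ℕ, ENNReal.ofReal (((n + 1 : ℕ) : ℝ)⁻¹) = ∞ := by
  by_contra h
  have h2 := ENNReal.summable_toReal h
  refine Real.not_summable_natCast_inv ((summable_nat_add_iff 1).1 (h2.congr fun n => ?_))
  rw [ENNReal.toReal_ofReal (by positivity)]

theorem lintegral_F (ha : 0 < a) (hs : ∀ x, x < a → d x = 0)
    (hd : ∀ x, 0 ≤ d x) (hm : Measurable d) (hi : Integrable d)
    (h1 : ∫ x, d x = 1) (hM : ∀ x, d x ≤ M) :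
    ∫⁻ x, ENNReal.ofReal (F d x) = ∞ := by
  have hg := measurable_convPow hm
  have h : ∀ x, ENNReal.ofReal (F d x) = ∑' n : ℕ,
      ENNReal.ofReal (convPow d (n + 1) x) * ENNReal.ofReal (((n + 1 : ℕ) : ℝ)⁻¹) := by
    intro x
    rw [F, ENNReal.ofReal_tsum_of_nonneg
      (fun n => div_nonneg (convPow_nonneg hd n x) (Nat.cast_nonneg _))
      (summable_series ha hs x)]
    refine tsum_congr fun n => ?_
    rw [div_eq_mul_inv, ENNReal.ofReal_mul (convPow_nonneg hd n x)]
  simp_rw [h]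
  rw [lintegral_tsum (fun n => by fun_prop), ← tsum_ofReal_harmonic]
  refine tsum_congr fun n => ?_
  rw [lintegral_mul_const _ (by fun_prop), lintegral_ofReal_convPow hd hm hi h1 hM, one_mul]

theorem not_memLp_one_F (ha : 0 < a) (hs : ∀ x, x < a → d x = 0)
    (hd : ∀ x, 0 ≤ d x) (hm : Measurable d) (hi : Integrable d)
    (h1 : ∫ x, d x = 1) (hM : ∀ x, d x ≤ M) :
    ¬ MemLp (F d) 1 (volume.restrict (Ioi 0)) := by
  intro h
  have h2 := h.eLpNorm_lt_top
  rw [eLpNorm_one_eq_lintegral_enorm] at h2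
  simp_rw [Real.enorm_of_nonneg (F_nonneg hd _)] at h2
  rw [setLIntegral_eq_of_support_subset] at h2
  · exact h2.ne (lintegral_F ha hs hd hm hi h1 hM)
  · intro x hx
    by_contra h'
    refine hx ?_
    simp only
    rw [F_eq_zero ha hs ((not_lt.1 h').trans_lt ha), ENNReal.ofReal_zero]

end

theorem measurable_of_continuousOn_of_eq_zero {d : ℝ → ℝ} {s : Set ℝ} (hs : MeasurableSet s)
    (h0 : ∀ x, x ∉ s → d x = 0) (hc : ContinuousOn d s) : Measurable d := by
  classical
  have h : d = s.piecewise d (fun _ => 0) := by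
    funext x
    by_cases hx : x ∈ s
    · simp [hx]
    · simp [hx, h0 x hx]
  rw [h]
  exact hc.measurable_piecewise continuousOn_const hs

end ConvolutionSeries

theorem corollary2p4 (d : ℝ → ℝ) (a b : ℝ) (ha : 0 < a)
    -- `d` is the density of a probability distribution supported in `[a, b]`
    (hd_nonneg : ∀ x, 0 ≤ d x)
    (hd_supp : ∀ x, x ∉ Set.Icc a b → d x = 0)
    (hd_int : ∫ x, d x = 1)
    -- `d` is `C²` on `(a, b)`, continuous up to the end points, and `d(a) d(b) ≠ 0`
    (hd_smooth : ContDiffOn ℝ 2 d (Set.Ioo a b))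
    (hd_cont : ContinuousOn d (Set.Icc a b))
    (hd_ends : d a * d b ≠ 0) :
    (ConvolutionSeries.MemWeakL1 (ConvolutionSeries.F d)
        (MeasureTheory.volume.restrict (Set.Ioi 0)) ∧
      ¬ MeasureTheory.MemLp (ConvolutionSeries.F d) 1
        (MeasureTheory.volume.restrict (Set.Ioi 0))) ∧
      MeasureTheory.MemLp (ConvolutionSeries.F d) 2
        (MeasureTheory.volume.restrict (Set.Ioi 0)) := by
  have hi : Integrable d := by
    -- A non-integrable `d` would have integral `0` by convention, not `1`.
    by_contra h
    simp [integral_undef h] at hd_int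
  have hm : Measurable d :=
    ConvolutionSeries.measurable_of_continuousOn_of_eq_zero measurableSet_Icc hd_supp hd_cont
  have hs : ∀ x, x < a → d x = 0 := fun x hx => hd_supp x fun h => absurd h.1 (not_le.2 hx)
  have hs' : ∀ x, b < x → d x = 0 := fun x hx => hd_supp x fun h => absurd h.2 (not_le.2 hx)
  have hb : 0 < b := by
    by_contra hb
    exact hd_ends (by rw [hs b (by linarith), mul_zero])
  obtain ⟨M, hM⟩ : ∃ M, ∀ x, d x ≤ M := by
    obtain ⟨K, hK⟩ := isCompact_Icc.bddAbove_image hd_cont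
    refine ⟨max K 0, fun x => ?_⟩
    by_cases hx : x ∈ Icc a b
    · exact le_max_of_le_left (hK (mem_image_of_mem d hx))
    · exact le_max_of_le_right (hd_supp x hx).le
  have hF := ConvolutionSeries.measurable_F ha hs hm
  have hF0 := ConvolutionSeries.F_nonneg hd_nonneg
  obtain ⟨C, hle⟩ :=
    ConvolutionSeries.exists_F_le_div ha hb hs hs' hd_nonneg hm hi hd_int hM
  exact ⟨⟨ConvolutionSeries.memWeakL1_of_le_div hF hF0 hle,
    ConvolutionSeries.not_memLp_one_F ha hs hd_nonneg hm hi hd_int hM⟩,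
    ConvolutionSeries.memLp_two_of_le_div hF ha hF0
      (fun x hx => ConvolutionSeries.F_eq_zero ha hs hx) hle⟩
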